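/- Let $\mathbb D=\{z\in\mathbb C:|z|<1\}$, let $(\alpha_n)_{n\in\mathbb Z}$ be a sequence in $\mathbb D$, put $\rho_n=(1-|\alpha_n|^2)^{1/2}$ and $$a_n=-\overline{\alpha_n}\,\alpha_{n-1},\quad b_n=\overline{\alpha_n}\,\rho_{n-1},\quad c_n=-\rho_n\alpha_{n-1},\quad d_n=\rho_n\rho_{n-1}.$$ The extended CMV matrix $\mathcal E$ with Verblunsky coefficients $(\alpha_n)$ acts on sequences $\varphi:\mathbb Z\to\mathbb C$ by $$(\mathcal E\varphi)_n=\begin{cases} b_n\varphi_{n-1}+a_n\varphi_n+b_{n+1}\varphi_{n+1}+d_{n+1}\varphi_{n+2}, & n \text{ even},\\ d_{n-1}\varphi_{n-2}+c_{n-1}\varphi_{n-1}+a_n\varphi_n+c_n\varphi_{n+1}, & n\text{ odd},\end{cases}$$ and is a unitary operator on $\ell^2(\mathbb Z)$, with spectrum $\sigma(\mathcal E)\subseteq\partial\mathbb D$. A number $z\in\mathbb C$ is a generalized eigenvalue of $\mathcal E$ if there is a nonzero sequence $\varphi:\mathbb Z\to\mathbb C$ (not necessarily in $\ell^2(\mathbb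 Z)$) with $\mathcal E\varphi=z\varphi$ and constants $R,S>0$ such that $|\varphi_n|\le R(1+|n|)^S$ for all $n\in\mathbb Z$; let $\mathcal G$ be the set of generalized eigenvalues of $\mathcal E$. For $\psi\in\ell^2(\mathbb Z)$ let $\mu_\psi$ be the spectral measure of $\psi$, i.e. the finite Borel measure on $\partial\mathbb D$ with $\int g\,d\mu_\psi=\langle\psi,g(\mathcal E)\psi\rangle$ for all continuous $g:\partial\mathbb D\to\mathbb C$, and let $\mu=\mu_{\delta_0}+\mu_{\delta_1}$, where $\delta_n$ is the standard basis of $\ell^2(\mathbb Z)$. **Theorem (Schnol's theorem for extended CMV matrices).** For every sequence $(\alpha_n)_{n\in\mathbb Z}$ in $\mathbb D$: (a) $\mathcal G\subseteq\sigma(\mathcal E)$; (b) $\mu(\sigma(\mathcal E)\setminus\mathcal G)=0$; (c) $\overline{\mathcal G}=\sigma(\mathcal E)$. -/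

import Mathlib

open scoped Complex.UnitDisc ComplexConjugate InnerProductSpace ENNReal CompactlySupported

noncomputable section

namespace CMV

/-- The Hilbert space `ℓ²(ℤ)` of square-summable complex sequences. -/
abbrev EllTwo : Type := lp (fun _ : ℤ => ℂ) 2

/-! ### The extended CMV matrix -/

/-- `ρ_n = (1 - |α_n|²)^{1/2}`. -/
def rho (α : ℤ → 𝔻) (n : ℤ) : ℝ := Real.sqrt (1 - ‖(α n : ℂ)‖ ^ 2)

/-- `a_n = -conj(α_n) α_{n-1}`. -/
def coeffA (α : ℤ → 𝔻) (n : ℤ) : ℂ := -(conj (α n : ℂ) * (α (n - 1) : ℂ))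

/-- `b_n = conj(α_n) ρ_{n-1}`. -/
def coeffB (α : ℤ → 𝔻) (n : ℤ) : ℂ := conj (α n : ℂ) * (rho α (n - 1) : ℂ)

/-- `c_n = -ρ_n α_{n-1}`. -/
def coeffC (α : ℤ → 𝔻) (n : ℤ) : ℂ := -((rho α n : ℂ) * (α (n - 1) : ℂ))

/-- `d_n = ρ_n ρ_{n-1}`. -/
def coeffD (α : ℤ → 𝔻) (n : ℤ) : ℂ := (rho α n : ℂ) * (rho α (n - 1) : ℂ)

/-- The extended CMV matrix acting (formally, row by row) on an arbitrary two-sided sequence.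
The row with even index `n` has the entries `b_n, a_n, b_{n+1}, d_{n+1}` in the columns
`n-1, n, n+1, n+2`; the row with odd index `n` has the entries `d_{n-1}, c_{n-1}, a_n, c_n`
in the columns `n-2, n-1, n, n+1`; all other entries are zero. -/
def act (α : ℤ → 𝔻) (φ : ℤ → ℂ) (n : ℤ) : ℂ :=
  if Even n then
    coeffB α n * φ (n - 1) + coeffA α n * φ n
      + coeffB α (n + 1) * φ (n + 1) + coeffD α (n + 1) * φ (n + 2)
  else
    coeffD α (n - 1) * φ (n - 2) + coeffC α (n - 1) * φ (n - 1)
      + coeffA α n * φ n + coeffC α n * φ (n + 1)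

theorem rho_nonneg (α : ℤ → 𝔻) (n : ℤ) : 0 ≤ rho α n := Real.sqrt_nonneg _

theorem rho_sq (α : ℤ → 𝔻) (n : ℤ) : rho α n ^ 2 = 1 - ‖(α n : ℂ)‖ ^ 2 :=
  Real.sq_sqrt (by have := (α n).sq_norm_lt_one; linarith)

theorem rho_sq_complex (α : ℤ → 𝔻) (n : ℤ) :
    (rho α n : ℂ) ^ 2 = 1 - (α n : ℂ) * conj (α n : ℂ) := by
  rw [Complex.mul_conj, Complex.normSq_eq_norm_sq]
  exact_mod_cast congrArg (fun x : ℝ => (x : ℂ)) (rho_sq α n)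

theorem rho_le_one (α : ℤ → 𝔻) (n : ℤ) : rho α n ≤ 1 := by
  have h1 := rho_sq α n
  have h2 := rho_nonneg α n
  nlinarith [sq_nonneg ‖(α n : ℂ)‖]

theorem norm_coeffA_le (α : ℤ → 𝔻) (n : ℤ) : ‖coeffA α n‖ ≤ 1 := by
  simp only [coeffA, norm_neg, norm_mul, RCLike.norm_conj]
  exact mul_le_one₀ (α n).norm_lt_one.le (norm_nonneg _) (α (n - 1)).norm_lt_one.le

theorem norm_coeffB_le (α : ℤ → 𝔻) (n : ℤ) : ‖coeffB α n‖ ≤ 1 := by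
  simp only [coeffB, norm_mul, RCLike.norm_conj, Complex.norm_real,
    Real.norm_of_nonneg (rho_nonneg _ _)]
  exact mul_le_one₀ (α n).norm_lt_one.le (rho_nonneg _ _) (rho_le_one _ _)

theorem norm_coeffC_le (α : ℤ → 𝔻) (n : ℤ) : ‖coeffC α n‖ ≤ 1 := by
  simp only [coeffC, norm_neg, norm_mul, Complex.norm_real,
    Real.norm_of_nonneg (rho_nonneg _ _)]
  exact mul_le_one₀ (rho_le_one _ _) (norm_nonneg _) (α (n - 1)).norm_lt_one.le

theorem norm_coeffD_le (α : ℤ → 𝔻) (n : ℤ) : ‖coeffD α n‖ ≤ 1 := by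
  simp only [coeffD, norm_mul, Complex.norm_real,
    Real.norm_of_nonneg (rho_nonneg _ _)]
  exact mul_le_one₀ (rho_le_one _ _) (rho_nonneg _ _) (rho_le_one _ _)

theorem norm_act_le (α : ℤ → 𝔻) (φ : ℤ → ℂ) (n : ℤ) :
    ‖act α φ n‖ ≤ ‖φ (n + -2)‖ + ‖φ (n + -1)‖ + ‖φ (n + 0)‖ + ‖φ (n + 1)‖ + ‖φ (n + 2)‖ := by
  have key : ∀ (c x : ℂ), ‖c‖ ≤ 1 → ‖c * x‖ ≤ ‖x‖ := fun c x hc => by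
    rw [norm_mul]; exact mul_le_of_le_one_left (norm_nonneg _) hc
  have four : ∀ x y z w : ℂ, ‖x + y + z + w‖ ≤ ‖x‖ + ‖y‖ + ‖z‖ + ‖w‖ := fun x y z w =>
    norm_add₄_le
  simp only [← sub_eq_add_neg, add_zero]
  unfold act
  split_ifs
  · have h := four (coeffB α n * φ (n - 1)) (coeffA α n * φ n)
      (coeffB α (n + 1) * φ (n + 1)) (coeffD α (n + 1) * φ (n + 2))
    have h1 := key _ (φ (n - 1)) (norm_coeffB_le α n)
    have h2 := key _ (φ n) (norm_coeffA_le α n)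
    have h3 := key _ (φ (n + 1)) (norm_coeffB_le α (n + 1))
    have h4 := key _ (φ (n + 2)) (norm_coeffD_le α (n + 1))
    linarith [norm_nonneg (φ (n - 2))]
  · have h := four (coeffD α (n - 1) * φ (n - 2)) (coeffC α (n - 1) * φ (n - 1))
      (coeffA α n * φ n) (coeffC α n * φ (n + 1))
    have h1 := key _ (φ (n - 2)) (norm_coeffD_le α (n - 1))
    have h2 := key _ (φ (n - 1)) (norm_coeffC_le α (n - 1))
    have h3 := key _ (φ n) (norm_coeffA_le α n)
    have h4 := key _ (φ (n + 1)) (norm_coeffC_le α n)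
    linarith [norm_nonneg (φ (n + 2))]

theorem hasSum_sq_shift (φ : EllTwo) (k : ℤ) :
    HasSum (fun n : ℤ => ‖φ (n + k)‖ ^ 2) (‖φ‖ ^ 2) := by
  have h := lp.hasSum_norm (p := 2) (by norm_num) φ
  simp only [ENNReal.toReal_ofNat, Real.rpow_ofNat] at h
  exact (Equiv.addRight k).hasSum_iff.mpr h

theorem hasSum_dominating (φ : EllTwo) :
    HasSum (fun n : ℤ => 5 * (‖φ (n + -2)‖ ^ 2 + ‖φ (n + -1)‖ ^ 2 + ‖φ (n + 0)‖ ^ 2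
      + ‖φ (n + 1)‖ ^ 2 + ‖φ (n + 2)‖ ^ 2)) ((5 * ‖φ‖) ^ 2) := by
  have h := (((((hasSum_sq_shift φ (-2)).add (hasSum_sq_shift φ (-1))).add
    (hasSum_sq_shift φ 0)).add (hasSum_sq_shift φ 1)).add (hasSum_sq_shift φ 2)).mul_left 5
  have e : (5 * ‖φ‖) ^ 2
      = 5 * (‖φ‖ ^ 2 + ‖φ‖ ^ 2 + ‖φ‖ ^ 2 + ‖φ‖ ^ 2 + ‖φ‖ ^ 2) := by ring
  rw [e]
  exact h

theorem norm_act_sq_le (α : ℤ → 𝔻) (φ : ℤ → ℂ) (n : ℤ) :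
    ‖act α φ n‖ ^ 2 ≤ 5 * (‖φ (n + -2)‖ ^ 2 + ‖φ (n + -1)‖ ^ 2 + ‖φ (n + 0)‖ ^ 2
      + ‖φ (n + 1)‖ ^ 2 + ‖φ (n + 2)‖ ^ 2) := by
  have h := norm_act_le α φ n
  have five : ∀ x y z w v : ℝ,
      (x + y + z + w + v) ^ 2 ≤ 5 * (x ^ 2 + y ^ 2 + z ^ 2 + w ^ 2 + v ^ 2) := fun x y z w v => by
    nlinarith [sq_nonneg (x - y), sq_nonneg (x - z), sq_nonneg (x - w), sq_nonneg (x - v),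
      sq_nonneg (y - z), sq_nonneg (y - w), sq_nonneg (y - v), sq_nonneg (z - w),
      sq_nonneg (z - v), sq_nonneg (w - v)]
  exact (pow_le_pow_left₀ (norm_nonneg _) h 2).trans (five _ _ _ _ _)

theorem memℓp_act (α : ℤ → 𝔻) (φ : EllTwo) : Memℓp (act α φ) 2 := by
  apply memℓp_gen
  simp only [ENNReal.toReal_ofNat, Real.rpow_ofNat]
  exact (hasSum_dominating φ).summable.of_nonneg_of_le (fun n => by positivity)
    (norm_act_sq_le α φ)

/-- The extended CMV matrix as a bounded operator on `ℓ²(ℤ)`. -/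
def op (α : ℤ → 𝔻) : EllTwo →L[ℂ] EllTwo :=
  LinearMap.mkContinuous
    { toFun := fun φ => ⟨act α φ, memℓp_act α φ⟩
      map_add' := fun φ ψ => by
        ext n
        simp only [act, lp.coeFn_add, Pi.add_apply]
        split_ifs <;> ring
      map_smul' := fun r φ => by
        ext n
        simp only [act, lp.coeFn_smul, Pi.smul_apply, smul_eq_mul, RingHom.id_apply]
        split_ifs <;> ring }
    5
    (fun φ => by
      apply lp.norm_le_of_tsum_le (p := 2) (by norm_num) (by positivity)
      simp only [ENNReal.toReal_ofNat, Real.rpow_ofNat]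
      rw [← (hasSum_dominating φ).tsum_eq]
      exact Summable.tsum_le_tsum (norm_act_sq_le α φ)
        ((hasSum_dominating φ).summable.of_nonneg_of_le (fun n => by positivity)
          (norm_act_sq_le α φ)) (hasSum_dominating φ).summable)

@[simp]
theorem op_apply (α : ℤ → 𝔻) (φ : EllTwo) (n : ℤ) : op α φ n = act α φ n := rfl

/-- The standard basis vector `δ_n` of `ℓ²(ℤ)`. -/
def delta (n : ℤ) : EllTwo := lp.single 2 n (1 : ℂ)

theorem delta_apply (n m : ℤ) : delta n m = if m = n then 1 else 0 := by
  simp [delta, lp.single_apply, Pi.single_apply]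

theorem op_delta (α : ℤ → 𝔻) (n : ℤ) :
    op α (delta n) =
      if Even n then
        coeffC α n • delta (n + 1) + coeffA α n • delta n
          + coeffC α (n - 1) • delta (n - 1) + coeffD α (n - 1) • delta (n - 2)
      else
        coeffB α n • delta (n - 1) + coeffA α n • delta n
          + coeffB α (n + 1) • delta (n + 1) + coeffD α (n + 1) • delta (n + 2) := by
  ext m
  have hm : m = n + 1 ∨ m = n ∨ m = n - 1 ∨ m = n - 2 ∨ m = n + 2 ∨
      (m ≠ n + 1 ∧ m ≠ n ∧ m ≠ n - 1 ∧ m ≠ n - 2 ∧ m ≠ n + 2) := by grind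
  by_cases hn : Even n
  · rw [if_pos hn]
    simp only [op_apply, act, lp.coeFn_add, lp.coeFn_smul, Pi.add_apply, Pi.smul_apply,
      smul_eq_mul, delta_apply]
    rcases hm with rfl | rfl | rfl | rfl | rfl | hm <;> grind
  · rw [if_neg hn]
    simp only [op_apply, act, lp.coeFn_add, lp.coeFn_smul, Pi.add_apply, Pi.smul_apply,
      smul_eq_mul, delta_apply]
    rcases hm with rfl | rfl | rfl | rfl | rfl | hm <;> grind

theorem inner_delta_left (n : ℤ) (φ : EllTwo) : ⟪delta n, φ⟫_ℂ = φ n := by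
  rw [delta, lp.inner_single_left]
  simp

theorem adjoint_apply (α : ℤ → 𝔻) (ψ : EllTwo) (n : ℤ) :
    ContinuousLinearMap.adjoint (op α) ψ n =
      if Even n then
        conj (coeffC α n) * ψ (n + 1) + conj (coeffA α n) * ψ n
          + conj (coeffC α (n - 1)) * ψ (n - 1) + conj (coeffD α (n - 1)) * ψ (n - 2)
      else
        conj (coeffB α n) * ψ (n - 1) + conj (coeffA α n) * ψ n
          + conj (coeffB α (n + 1)) * ψ (n + 1) + conj (coeffD α (n + 1)) * ψ (n + 2) := by
  rw [← inner_delta_left, ContinuousLinearMap.adjoint_inner_right, op_delta]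
  split_ifs <;> simp only [inner_add_left, inner_smul_left, inner_delta_left]

theorem op_mem_unitary (α : ℤ → 𝔻) : op α ∈ unitary (EllTwo →L[ℂ] EllTwo) := by
  rw [Unitary.mem_iff]
  have r : ∀ n, (rho α n : ℂ) ^ 2 = 1 - (α n : ℂ) * conj (α n : ℂ) := rho_sq_complex α
  constructor
  · ext φ n
    rw [ContinuousLinearMap.star_eq_adjoint, mul_apply_eq_comp, adjoint_apply,
      one_apply_eq_self]
    simp only [op_apply, act]
    have r0 := r n
    have r1 := r (n - 1)
    have r2 := r (n + 1)
    have r3 := r (n - 2)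
    by_cases hn : Even n
    · have e1 : ¬ Even (n + 1) := by grind
      have e2 : ¬ Even (n - 1) := by grind
      have e3 : Even (n - 2) := by grind
      simp only [if_pos hn, if_neg e1, if_neg e2, if_pos e3, coeffA, coeffB, coeffC, coeffD,
        map_neg, map_mul, Complex.conj_conj, Complex.conj_ofReal]
      ring_nf at *
      grind
    · have e1 : Even (n + 1) := by grind
      have e2 : Even (n - 1) := by grind
      have e3 : ¬ Even (n + 2) := by grind
      simp only [if_neg hn, if_pos e1, if_pos e2, if_neg e3, coeffA, coeffB, coeffC, coeffD,
        map_neg, map_mul, Complex.conj_conj, Complex.conj_ofReal]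
      ring_nf at *
      grind
  · ext φ n
    rw [ContinuousLinearMap.star_eq_adjoint, mul_apply_eq_comp, op_apply,
      one_apply_eq_self, act]
    simp only [adjoint_apply]
    have r0 := r n
    have r1 := r (n - 1)
    have r2 := r (n + 1)
    have r3 := r (n - 2)
    by_cases hn : Even n
    · have e1 : ¬ Even (n + 1) := by grind
      have e2 : ¬ Even (n - 1) := by grind
      have e3 : Even (n + 2) := by grind
      simp only [if_pos hn, if_neg e1, if_neg e2, if_pos e3, coeffA, coeffB, coeffC, coeffD,
        map_neg, map_mul, Complex.conj_conj, Complex.conj_ofReal]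
      ring_nf at *
      grind
    · have e1 : Even (n + 1) := by grind
      have e2 : Even (n - 1) := by grind
      have e3 : ¬ Even (n - 2) := by grind
      simp only [if_neg hn, if_pos e1, if_pos e2, if_neg e3, coeffA, coeffB, coeffC, coeffD,
        map_neg, map_mul, Complex.conj_conj, Complex.conj_ofReal]
      ring_nf at *
      grind

/-- The extended CMV matrix with Verblunsky coefficients `α`, a unitary operator on `ℓ²(ℤ)`. -/
def extendedCMV (α : ℤ → 𝔻) : unitary (EllTwo →L[ℂ] EllTwo) := ⟨op α, op_mem_unitary α⟩

/-! ### Generalized eigenvalues -/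

/-- `φ` is a generalized eigenvector with generalized eigenvalue `z`: a nonzero, polynomially
bounded sequence (not necessarily in `ℓ²(ℤ)`) with `ℰ φ = z φ`. -/
def IsGeneralizedEigenvector (α : ℤ → 𝔻) (z : ℂ) (φ : ℤ → ℂ) : Prop :=
  φ ≠ 0 ∧ act α φ = z • φ ∧
    ∃ R S : ℝ, 0 < R ∧ 0 < S ∧ ∀ n : ℤ, ‖φ n‖ ≤ R * (1 + |(n : ℝ)|) ^ S

/-- The set of generalized eigenvalues of the extended CMV matrix. -/
def generalizedEigenvalues (α : ℤ → 𝔻) : Set ℂ :=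
  {z | ∃ φ : ℤ → ℂ, IsGeneralizedEigenvector α z φ}

/-! ### Spectral measures of unitary operators -/

/-- The Borel σ-algebra of the unit circle. -/
instance : MeasurableSpace Circle := borel Circle

instance : BorelSpace Circle := ⟨rfl⟩

section SpectralMeasure

variable {H : Type*} [NormedAddCommGroup H] [InnerProductSpace ℂ H] [CompleteSpace H]

/-- The functional calculus `g ↦ g(U)` of a unitary operator `U`, for continuous functions `g` on
the unit circle: restrict `g` to the spectrum and apply the continuous functional calculus. -/
def circleCalculus (U : unitary (H →L[ℂ] H)) : C(Circle, ℂ) →⋆ₐ[ℂ] (H →L[ℂ] H) :=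
  (cfcHom (R := ℂ) (a := (U : H →L[ℂ] H)) (p := IsStarNormal) inferInstance).comp
    (ContinuousMap.compStarAlgHom' ℂ ℂ
      ⟨fun z => (⟨z, Unitary.spectrum_subset_circle U z.2⟩ : Circle), by fun_prop⟩)

/-- A real-valued function regarded as a complex-valued one. -/
def toComplex (f : C(Circle, ℝ)) : C(Circle, ℂ) := ⟨fun z => (f z : ℂ), by fun_prop⟩

theorem spectralFunctional_nonneg (U : unitary (H →L[ℂ] H)) (ψ : H) (f : C(Circle, ℝ))
    (hf : ∀ z, 0 ≤ f z) : 0 ≤ (⟪ψ, circleCalculus U (toComplex f) ψ⟫_ℂ).re := by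
  let s : C(Circle, ℝ) := ⟨fun z => Real.sqrt (f z), by fun_prop⟩
  have h : toComplex f = star (toComplex s) * toComplex s := by
    ext z
    simp only [toComplex, ContinuousMap.coe_mk, ContinuousMap.mul_apply,
      ContinuousMap.star_apply, s, RCLike.star_def, Complex.conj_ofReal]
    rw [← Complex.ofReal_mul, Real.mul_self_sqrt (hf z)]
  rw [h, map_mul, map_star, mul_apply_eq_comp, ContinuousLinearMap.star_eq_adjoint,
    ContinuousLinearMap.adjoint_inner_right]
  exact inner_self_nonneg (𝕜 := ℂ)

/-- The positive functional `f ↦ ⟨ψ, f(U) ψ⟩` on real continuous functions on the circle. -/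
def spectralFunctional (U : unitary (H →L[ℂ] H)) (ψ : H) : C_c(Circle, ℝ) →ₚ[ℝ] ℝ :=
  PositiveLinearMap.mk₀
    { toFun := fun f => (⟪ψ, circleCalculus U (toComplex f) ψ⟫_ℂ).re
      map_add' := fun f g => by
        have h : toComplex ((f + g : C_c(Circle, ℝ)) : C(Circle, ℝ))
            = toComplex f + toComplex g := by
          ext z; simp [toComplex]
        rw [h, map_add, add_apply, inner_add_right, Complex.add_re]
      map_smul' := fun r f => by
        have h : toComplex ((r • f : C_c(Circle, ℝ)) : C(Circle, ℝ))
            = (r : ℂ) • toComplex f := by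
          ext z; simp [toComplex]
        rw [h, map_smul, smul_apply, inner_smul_right,
          Complex.re_ofReal_mul, RingHom.id_apply, smul_eq_mul] }
    (fun f hf => spectralFunctional_nonneg U ψ f hf)

/-- The spectral measure of `ψ` with respect to the unitary operator `U`: the measure on the unit
circle that represents the functional `g ↦ ⟨ψ, g(U) ψ⟩`. -/
def spectralMeasure (U : unitary (H →L[ℂ] H)) (ψ : H) : MeasureTheory.Measure Circle :=
  RealRMK.rieszMeasure (spectralFunctional U ψ)

instance (U : unitary (H →L[ℂ] H)) (ψ : H) :
    MeasureTheory.IsFiniteMeasure (spectralMeasure U ψ) := by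
  have : (spectralMeasure U ψ).Regular := by
    unfold spectralMeasure; infer_instance
  exact ⟨isCompact_univ.measure_lt_top⟩

/-- The defining property of the spectral measure. -/
theorem integral_spectralMeasure (U : unitary (H →L[ℂ] H)) (ψ : H) (g : C(Circle, ℂ)) :
    ∫ z, g z ∂(spectralMeasure U ψ) = ⟪ψ, circleCalculus U g ψ⟫_ℂ := by
  have real_case : ∀ f : C(Circle, ℝ),
      ∫ z, (f z : ℂ) ∂(spectralMeasure U ψ) = ⟪ψ, circleCalculus U (toComplex f) ψ⟫_ℂ := by
    intro f
    have h1 : ∫ z, f z ∂(spectralMeasure U ψ)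
        = (⟪ψ, circleCalculus U (toComplex f) ψ⟫_ℂ).re :=
      RealRMK.integral_rieszMeasure (spectralFunctional U ψ)
        ⟨f, HasCompactSupport.of_compactSpace f⟩
    have h2 : conj ⟪ψ, circleCalculus U (toComplex f) ψ⟫_ℂ
        = ⟪ψ, circleCalculus U (toComplex f) ψ⟫_ℂ := by
      have hs : star (toComplex f) = toComplex f := by
        ext z; simp [toComplex]
      rw [inner_conj_symm]
      conv_rhs => rw [← hs, map_star, ContinuousLinearMap.star_eq_adjoint,
        ContinuousLinearMap.adjoint_inner_right]
    rw [integral_complex_ofReal, h1]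
    exact Complex.conj_eq_iff_re.mp h2
  have integ : ∀ f : C(Circle, ℂ), MeasureTheory.Integrable f (spectralMeasure U ψ) := fun f =>
    f.continuous.integrable_of_hasCompactSupport (HasCompactSupport.of_compactSpace f)
  let gr : C(Circle, ℝ) := ⟨fun z => (g z).re, by fun_prop⟩
  let gi : C(Circle, ℝ) := ⟨fun z => (g z).im, by fun_prop⟩
  have hg : g = toComplex gr + Complex.I • toComplex gi := by
    ext z
    simp only [toComplex, gr, gi, ContinuousMap.add_apply, ContinuousMap.smul_apply,
      ContinuousMap.coe_mk, smul_eq_mul]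
    rw [mul_comm, Complex.re_add_im]
  rw [hg, map_add, map_smul, add_apply, smul_apply, inner_add_right,
    inner_smul_right, ← real_case, ← real_case, ← MeasureTheory.integral_const_mul]
  exact MeasureTheory.integral_add (integ (toComplex gr)) (integ (Complex.I • toComplex gi))

end SpectralMeasure

/-- The canonical spectral measure `μ_{δ_0} + μ_{δ_1}` of the extended CMV matrix. -/
def canonicalSpectralMeasure (α : ℤ → 𝔻) : MeasureTheory.Measure Circle :=
  spectralMeasure (extendedCMV α) (delta 0) + spectralMeasure (extendedCMV α) (delta 1)

end CMV
end

noncomputable section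

namespace CMV

open MeasureTheory

/-! ### Generalized eigenvalues belong to the spectrum -/

/-! A generalized eigenvector is turned into approximate eigenvectors in `ℓ²` by damping: `ψ n = exp
(-ε |n|) φ n`. The matrix has bandwidth 2 and the weight changes by a factor of at most `exp (2ε)`
over two sites, so `‖(ℰ - z) ψ‖ ≤ 5 (exp (2ε) - 1) ‖ψ‖`. As `ε → 0` this rules out a bounded inverse
of `z - ℰ`, hence `𝒢 ⊆ σ(ℰ)` (`generalizedEigenvalues_subset_spectrum`).

For the converse, eigenvectors are produced as densities. For `k = 0, 1` the functional `g ↦ ⟨δ_n,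
g(ℰ) δ_k⟩` has a density `f n` in `L²(μ)` of norm at most 1 (`exists_density`). Testing against `z
g(z)` shows that `n ↦ f n z` solves the eigenvalue equation for almost every `z`, and a weighted sum
over `n` gives linear growth (`ae_exists_norm_le`). The diagonal densities for `k = 0` and `k = 1`
add up to 1, so at almost every `z` one of the two solutions is nonzero
(`ae_mem_generalizedEigenvalues`).

Finally `δ_0, δ_1` determine everything that commutes with `ℰ` and `ℰ*`
(`eq_zero_of_apply_delta_zero_one`), so a continuous `g` vanishing `μ`-almost everywhere has `g(ℰ) =
0` and thus vanishes on the spectrum. A bump function at a spectral point away from the closure of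
`𝒢` would contradict this. -/

/-- Polynomially bounded sequences on `ℤ` become square-summable after multiplication by an
exponentially decaying weight. -/
theorem memℓp_exp_mul {φ : ℤ → ℂ} {R S : ℝ} (hR : 0 < R)
    (h : ∀ n : ℤ, ‖φ n‖ ≤ R * (1 + |(n : ℝ)|) ^ S) {ε : ℝ} (hε : 0 < ε) :
    Memℓp (fun n : ℤ => (Real.exp (-ε * |(n : ℝ)|) : ℂ) * φ n) 2 := by
  obtain ⟨k, hk⟩ := exists_nat_ge S
  have hq : ‖Real.exp (-(2 * ε))‖ < 1 := by
    rw [Real.norm_of_nonneg (Real.exp_pos _).le]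
    rw [Real.exp_lt_one_iff]
    linarith
  have hs : Summable fun n : ℕ =>
      R ^ 2 * ((1 + (n : ℝ)) ^ (2 * k) * Real.exp (-(2 * ε)) ^ n) := by
    -- The base is `1 + n`, so the standard series is shifted by one index; the surplus factor `exp
    -- (-(2ε))` is divided out below.
    have h1 : Summable fun n : ℕ =>
        ((n + 1 : ℕ) : ℝ) ^ (2 * k) * Real.exp (-(2 * ε)) ^ (n + 1) :=
      (summable_nat_add_iff (f := fun n : ℕ => (n : ℝ) ^ (2 * k) * Real.exp (-(2 * ε)) ^ n) 1).mpr
        (summable_pow_mul_geometric_of_norm_lt_one (2 * k) hq)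
    refine ((h1.mul_left (Real.exp (-(2 * ε)))⁻¹).mul_left (R ^ 2)).congr fun n => ?_
    have := (Real.exp_pos (-(2 * ε))).ne'
    push_cast
    field_simp
    ring
  have hsZ : Summable fun n : ℤ =>
      R ^ 2 * ((1 + |(n : ℝ)|) ^ (2 * k) * Real.exp (-(2 * ε)) ^ n.natAbs) := by
    apply Summable.of_nat_of_neg <;> simpa using hs
  apply memℓp_gen
  simp only [ENNReal.toReal_ofNat, Real.rpow_ofNat]
  refine hsZ.of_nonneg_of_le (fun n => by positivity) fun n => ?_
  have h1 : ‖φ n‖ ≤ R * (1 + |(n : ℝ)|) ^ k := by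
    refine (h n).trans (mul_le_mul_of_nonneg_left ?_ hR.le)
    rw [← Real.rpow_natCast]
    exact Real.rpow_le_rpow_of_exponent_le (by linarith [abs_nonneg (n : ℝ)]) hk
  have h2 : Real.exp (-ε * |(n : ℝ)|) ^ 2 = Real.exp (-(2 * ε)) ^ n.natAbs := by
    rw [← Real.exp_nat_mul, ← Real.exp_nat_mul, Nat.cast_natAbs, Int.cast_abs]
    congr 1
    push_cast
    ring
  rw [norm_mul, mul_pow, Complex.norm_real, Real.norm_of_nonneg (Real.exp_pos _).le, h2]
  calc _ ≤ Real.exp (-(2 * ε)) ^ n.natAbs * (R * (1 + |(n : ℝ)|) ^ k) ^ 2 := by gcongr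
    _ = _ := by ring

/-- The distance 2 is the bandwidth of `ℰ`. The ratio of the weights lies between `exp (-2ε)` and
`exp (2ε)`; the lower side is also within `exp (2ε) - 1` of 1, because `x + x⁻¹ ≥ 2`. -/
theorem abs_exp_sub_exp_le {ε : ℝ} (hε : 0 < ε) {m n : ℝ} (h : |m - n| ≤ 2) :
    |Real.exp (-ε * |m|) - Real.exp (-ε * |n|)| ≤
      (Real.exp (2 * ε) - 1) * Real.exp (-ε * |m|) := by
  have h1 : |(|m| - |n|)| ≤ 2 := (abs_abs_sub_abs_le m n).trans h
  have e : Real.exp (-ε * |n|) = Real.exp (ε * (|m| - |n|)) * Real.exp (-ε * |m|) := by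
    rw [← Real.exp_add]; congr 1; ring
  rw [e, ← one_sub_mul, abs_mul, abs_of_pos (Real.exp_pos (-ε * |m|))]
  refine mul_le_mul_of_nonneg_right ?_ (Real.exp_pos _).le
  rw [abs_le] at h1
  have hu : Real.exp (ε * (|m| - |n|)) ≤ Real.exp (2 * ε) := Real.exp_le_exp.mpr (by nlinarith)
  have hl : Real.exp (-(2 * ε)) ≤ Real.exp (ε * (|m| - |n|)) := Real.exp_le_exp.mpr (by nlinarith)
  have hp : Real.exp (2 * ε) * Real.exp (-(2 * ε)) = 1 := by rw [← Real.exp_add]; simp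
  rw [abs_le]
  constructor <;> nlinarith [Real.exp_pos (2 * ε), Real.exp_pos (-(2 * ε)),
    sq_nonneg (Real.exp (2 * ε) - 1)]

theorem act_sub (α : ℤ → 𝔻) (φ ψ : ℤ → ℂ) : act α (φ - ψ) = act α φ - act α ψ := by
  ext n
  simp only [act, Pi.sub_apply]
  split_ifs <;> ring

theorem act_smul (α : ℤ → 𝔻) (c : ℂ) (φ : ℤ → ℂ) : act α (c • φ) = c • act α φ := by
  ext n
  simp only [act, Pi.smul_apply, smul_eq_mul]
  split_ifs <;> ring

/-- The commutator of the extended CMV matrix with an exponential weight is small relative to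
the weight. -/
theorem norm_act_exp_mul_sub_le (α : ℤ → 𝔻) {φ : ℤ → ℂ} {z : ℂ} (h : act α φ = z • φ)
    {ε : ℝ} (hε : 0 < ε) (ψ : EllTwo)
    (hψ : ∀ n : ℤ, ψ n = (Real.exp (-ε * |(n : ℝ)|) : ℂ) * φ n) :
    ‖op α ψ - z • ψ‖ ≤ (Real.exp (2 * ε) - 1) * (5 * ‖ψ‖) := by
  set δ := Real.exp (2 * ε) - 1 with hδ
  have hδ0 : 0 ≤ δ := by
    have := Real.one_le_exp (x := 2 * ε) (by positivity)
    linarith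
  have hdom := (hasSum_dominating ψ).mul_left (δ ^ 2)
  have key : ∀ n : ℤ, ‖(op α ψ - z • ψ) n‖ ^ 2 ≤
      δ ^ 2 * (5 * (‖ψ (n + -2)‖ ^ 2 + ‖ψ (n + -1)‖ ^ 2 + ‖ψ (n + 0)‖ ^ 2
      + ‖ψ (n + 1)‖ ^ 2 + ‖ψ (n + 2)‖ ^ 2)) := by
    intro n
    -- Freeze the weight at the row index: subtracting the constant multiple `exp (-ε |n|) φ`, an
    -- exact formal eigenvector, leaves only differences of weights in row `n`.
    have e : (op α ψ - z • ψ) n =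
        act α ((ψ : ℤ → ℂ) - (Real.exp (-ε * |(n : ℝ)|) : ℂ) • φ) n := by
      rw [act_sub, act_smul, h]
      simp only [lp.coeFn_sub, lp.coeFn_smul, Pi.sub_apply, Pi.smul_apply, op_apply, smul_eq_mul,
        hψ n]
      ring
    rw [e]
    refine (norm_act_sq_le _ _ _).trans ?_
    -- The weight difference is measured relative to the weight at `n + j`, so that the bound is by
    -- `ψ` itself, which is square-summable, and not by `φ`.
    have b : ∀ j : ℤ, |(j : ℝ)| ≤ 2 →
        ‖((ψ : ℤ → ℂ) - (Real.exp (-ε * |(n : ℝ)|) : ℂ) • φ) (n + j)‖ ^ 2 ≤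
          δ ^ 2 * ‖ψ (n + j)‖ ^ 2 := by
      intro j hj
      rw [← mul_pow]
      refine pow_le_pow_left₀ (norm_nonneg _) ?_ 2
      rw [Pi.sub_apply, Pi.smul_apply, hψ, smul_eq_mul, ← sub_mul, norm_mul, norm_mul, ← mul_assoc]
      refine mul_le_mul_of_nonneg_right ?_ (norm_nonneg _)
      rw [← Complex.ofReal_sub, Complex.norm_real, Complex.norm_real, Real.norm_eq_abs,
        Real.norm_of_nonneg (Real.exp_pos _).le]
      exact abs_exp_sub_exp_le hε (by push_cast; simpa using hj)
    have b1 := b (-2) (by norm_num)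
    have b2 := b (-1) (by norm_num)
    have b3 := b 0 (by norm_num)
    have b4 := b 1 (by norm_num)
    have b5 := b 2 (by norm_num)
    linarith
  apply lp.norm_le_of_tsum_le (p := 2) (by norm_num) (by positivity)
  simp only [ENNReal.toReal_ofNat, Real.rpow_ofNat]
  rw [mul_pow, ← hdom.tsum_eq]
  exact Summable.tsum_le_tsum key
    (hdom.summable.of_nonneg_of_le (fun n => by positivity) key) hdom.summable

theorem generalizedEigenvalues_subset_spectrum (α : ℤ → 𝔻) :
    generalizedEigenvalues α ⊆ spectrum ℂ (op α) := by
  -- The spectrum is by definition the complement of the resolvent set, so `hz` places `z` in the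
  -- resolvent set and the goal is a contradiction.
  rintro z ⟨φ, hφ0, hφ, R, S, hR, -, hb⟩ hz
  obtain ⟨u, hu⟩ : IsUnit (algebraMap ℂ (EllTwo →L[ℂ] EllTwo) z - op α) := hz
  set T : EllTwo →L[ℂ] EllTwo := ((u⁻¹ : (EllTwo →L[ℂ] EllTwo)ˣ) : EllTwo →L[ℂ] EllTwo)
  have hT : ∀ ψ : EllTwo, ‖ψ‖ ≤ ‖T‖ * ‖op α ψ - z • ψ‖ := by
    intro ψ
    have h1 : T ((algebraMap ℂ (EllTwo →L[ℂ] EllTwo) z - op α) ψ) = ψ := by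
      rw [← hu]
      exact congrArg (fun A : EllTwo →L[ℂ] EllTwo => A ψ) u.inv_mul
    have h2 : (algebraMap ℂ (EllTwo →L[ℂ] EllTwo) z - op α) ψ = -(op α ψ - z • ψ) := by
      rw [Algebra.algebraMap_eq_smul_one]
      simp
    calc ‖ψ‖ = ‖T (-(op α ψ - z • ψ))‖ := by rw [← h2, h1]
      _ ≤ _ := (T.le_opNorm _).trans_eq (by rw [norm_neg])
  obtain ⟨ε, hε, hsmall⟩ : ∃ ε : ℝ, 0 < ε ∧ ‖T‖ * ((Real.exp (2 * ε) - 1) * 5) < 1 := by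
    have hc : Filter.Tendsto (fun ε : ℝ => ‖T‖ * ((Real.exp (2 * ε) - 1) * 5))
        (nhdsWithin 0 (Set.Ioi 0)) (nhds (‖T‖ * ((Real.exp (2 * 0) - 1) * 5))) :=
      (Continuous.tendsto (by fun_prop) 0).mono_left nhdsWithin_le_nhds
    have := (hc.eventually_lt_const (u := 1) (by simp)).and self_mem_nhdsWithin
    obtain ⟨ε, h1, h2⟩ := this.exists
    exact ⟨ε, h2, h1⟩
  let ψ : EllTwo := ⟨_, memℓp_exp_mul hR hb hε⟩
  have h1 := hT ψ
  have h2 := norm_act_exp_mul_sub_le α hφ hε ψ fun _ => rfl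
  have h3 : ψ ≠ 0 := by
    intro h0
    apply hφ0
    ext n
    have : (Real.exp (-ε * |(n : ℝ)|) : ℂ) * φ n = 0 :=
      congrArg (fun f : EllTwo => f n) h0
    simpa [Real.exp_ne_zero] using this
  have h4 := norm_pos_iff.mpr h3
  have h5 := mul_le_mul_of_nonneg_left h2 (norm_nonneg T)
  nlinarith

end CMV
end

noncomputable section

namespace CMV

open MeasureTheory

/-! ### Densities of matrix elements of the functional calculus -/

section Density

variable {H : Type*} [NormedAddCommGroup H] [InnerProductSpace ℂ H] [CompleteSpace H]

/-- The embedding of the circle into the complex plane. -/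
def circleVal : C(Circle, ℂ) := ⟨fun z => (z : ℂ), by fun_prop⟩

theorem circleCalculus_circleVal (U : unitary (H →L[ℂ] H)) :
    circleCalculus U circleVal = (U : H →L[ℂ] H) :=
  cfcHom_id (R := ℂ) (a := (U : H →L[ℂ] H)) (p := IsStarNormal) inferInstance

/-- Since `g(U)* g(U) = |g|²(U)`, the map `g ↦ g(U) ψ` is isometric for the `L²` norm of the
spectral measure of `ψ`. -/
theorem norm_circleCalculus_sq (U : unitary (H →L[ℂ] H)) (ψ : H) (g : C(Circle, ℂ)) :
    ‖circleCalculus U g ψ‖ ^ 2 = ∫ z, ‖g z‖ ^ 2 ∂(spectralMeasure U ψ) := by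
  have h := integral_spectralMeasure U ψ (star g * g)
  rw [map_mul, map_star, mul_apply_eq_comp, ContinuousLinearMap.star_eq_adjoint,
    ContinuousLinearMap.adjoint_inner_right, inner_self_eq_norm_sq_to_K] at h
  have e : ∀ z, (star g * g) z = ((‖g z‖ ^ 2 : ℝ) : ℂ) := fun z => by
    simp [Complex.conj_mul']
  simp only [e] at h
  rw [integral_complex_ofReal] at h
  apply Complex.ofReal_injective
  rw [Complex.ofReal_pow]
  exact h.symm

variable {μ : Measure Circle} [IsFiniteMeasure μ]

theorem norm_toLp_sq (g : C(Circle, ℂ)) :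
    ‖ContinuousMap.toLp 2 μ ℂ g‖ ^ 2 = ∫ z, ‖g z‖ ^ 2 ∂μ := by
  have h := L2.inner_def (𝕜 := ℂ) (ContinuousMap.toLp (E := ℂ) 2 μ ℂ g)
    (ContinuousMap.toLp (E := ℂ) 2 μ ℂ g)
  rw [inner_self_eq_norm_sq_to_K] at h
  have e : ∫ z, ⟪ContinuousMap.toLp (E := ℂ) 2 μ ℂ g z, ContinuousMap.toLp (E := ℂ) 2 μ ℂ g z⟫_ℂ ∂μ
      = ∫ z, ((‖g z‖ ^ 2 : ℝ) : ℂ) ∂μ := by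
    refine integral_congr_ae ?_
    filter_upwards [ContinuousMap.coeFn_toLp (𝕜 := ℂ) (p := 2) μ g] with z hz
    rw [hz, inner_self_eq_norm_sq_to_K]
    norm_cast
  rw [e, integral_complex_ofReal] at h
  apply Complex.ofReal_injective
  rw [Complex.ofReal_pow]
  exact h

theorem integrable_mul_continuous {f : Circle → ℂ} (hf : MemLp f 2 μ) (g : C(Circle, ℂ)) :
    Integrable (fun z => f z * g z) μ :=
  hf.integrable_mul (g.memLp (p := 2) μ ℂ)

/-- The conjugate of `f` is orthogonal in `L²(μ)` to the continuous functions, which are dense. -/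
theorem ae_eq_zero_of_integral_mul_continuous_eq_zero {f : Circle → ℂ} (hf : MemLp f 2 μ)
    (h : ∀ g : C(Circle, ℂ), ∫ z, f z * g z ∂μ = 0) : f =ᵐ[μ] 0 := by
  have hd := ContinuousMap.toLp_denseRange ℂ μ ℂ (p := 2) (by norm_num)
  have h0 : hf.star.toLp = 0 := by
    refine hd.eq_zero_of_inner_left ℂ fun g => ?_
    rw [← h g, L2.inner_def]
    refine integral_congr_ae ?_
    filter_upwards [ContinuousMap.coeFn_toLp (𝕜 := ℂ) (p := 2) μ g, hf.star.coeFn_toLp]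
      with z hz hz'
    rw [hz, hz']
    simp [mul_comm]
  have h1 := hf.star.coeFn_toLp
  rw [h0] at h1
  filter_upwards [h1, Lp.coeFn_zero ℂ 2 μ] with z h2 h3
  rw [h3] at h2
  simpa using h2.symm

/-- The matrix elements `⟨η, g(U) ψ⟩` have a square-integrable density with respect to any finite
measure that dominates the spectral measure of `ψ`. -/
theorem exists_density (U : unitary (H →L[ℂ] H)) (ψ η : H) (hμ : spectralMeasure U ψ ≤ μ) :
    ∃ f : Circle → ℂ, MemLp f 2 μ ∧ eLpNorm f 2 μ ≤ ENNReal.ofReal ‖η‖ ∧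
      ∀ g : C(Circle, ℂ), ∫ z, f z * g z ∂μ = ⟪η, circleCalculus U g ψ⟫_ℂ := by
  have hd := ContinuousMap.toLp_denseRange ℂ μ ℂ (p := 2) (by norm_num)
  let F : C(Circle, ℂ) →ₗ[ℂ] H :=
    { toFun := fun g => circleCalculus U g ψ
      map_add' := fun g g' => by rw [map_add, add_apply]
      map_smul' := fun c g => by rw [map_smul, smul_apply, RingHom.id_apply] }
  let e : C(Circle, ℂ) →ₗ[ℂ] Lp ℂ 2 μ := (ContinuousMap.toLp 2 μ ℂ).toLinearMap
  have hF : ∀ g, ‖F g‖ ≤ 1 * ‖e g‖ := by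
    intro g
    rw [one_mul]
    refine (sq_le_sq₀ (norm_nonneg _) (norm_nonneg _)).mp ?_
    change ‖circleCalculus U g ψ‖ ^ 2 ≤ ‖ContinuousMap.toLp 2 μ ℂ g‖ ^ 2
    rw [norm_circleCalculus_sq, norm_toLp_sq]
    refine integral_mono_measure hμ (Filter.Eventually.of_forall fun z => by positivity) ?_
    exact (by fun_prop : Continuous fun z => ‖g z‖ ^ 2).integrable_of_hasCompactSupport
      (HasCompactSupport.of_compactSpace _)
  -- Because `μ` dominates the spectral measure, `g ↦ g(U) ψ` is a contraction for the `L²(μ)` norm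
  -- and extends to `V : L²(μ) → H`. The density is the conjugate of `V* η`, the inner product being
  -- conjugate-linear in its first slot.
  let V := F.extendOfNorm e
  have hV : ∀ g, V (e g) = F g := LinearMap.extendOfNorm_eq hd ⟨1, hF⟩
  have hVn : ‖V‖ ≤ 1 := LinearMap.opNorm_extendOfNorm_le hd zero_le_one hF
  let h := ContinuousLinearMap.adjoint V η
  have hn : ‖h‖ ≤ ‖η‖ := by
    refine (ContinuousLinearMap.le_opNorm _ _).trans ?_
    rw [LinearIsometryEquiv.norm_map]
    exact mul_le_of_le_one_left (norm_nonneg _) hVn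
  refine ⟨star (h : Circle → ℂ), (Lp.memLp h).star, ?_, fun g => ?_⟩
  · rw [eLpNorm_star, ← Lp.enorm_def, ← ofReal_norm]
    exact ENNReal.ofReal_le_ofReal hn
  · change _ = ⟪η, F g⟫_ℂ
    rw [← hV, ← ContinuousLinearMap.adjoint_inner_left, L2.inner_def]
    refine integral_congr_ae ?_
    filter_upwards [ContinuousMap.coeFn_toLp (𝕜 := ℂ) (p := 2) μ g] with z hz
    change _ = ⟪h z, ContinuousMap.toLp 2 μ ℂ g z⟫_ℂ
    rw [hz]
    simp [mul_comm]

end Density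

end CMV
end

noncomputable section

namespace CMV

open MeasureTheory

/-! ### Almost every spectral parameter is a generalized eigenvalue -/

section AlmostEvery

variable {μ : Measure Circle}

theorem integral_act (α : ℤ → 𝔻) {u : ℤ → Circle → ℂ} (hu : ∀ m, Integrable (u m) μ) (n : ℤ) :
    ∫ z, act α (fun m => u m z) n ∂μ = act α (fun m => ∫ z, u m z ∂μ) n := by
  have h : ∀ (c : ℂ) m, Integrable (fun z => c * u m z) μ := fun c m => (hu m).const_mul c
  unfold act
  split_ifs
  all_goals
    rw [integral_add (((h _ _).fun_add (h _ _)).fun_add (h _ _)) (h _ _),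
      integral_add ((h _ _).fun_add (h _ _)) (h _ _), integral_add (h _ _) (h _ _)]
    simp only [integral_const_mul]

theorem memLp_act (α : ℤ → 𝔻) {u : ℤ → Circle → ℂ} (hu : ∀ m, MemLp (u m) 2 μ) (n : ℤ) :
    MemLp (fun z => act α (fun m => u m z) n) 2 μ := by
  have h : ∀ (c : ℂ) m, MemLp (fun z => c * u m z) 2 μ := fun c m => (hu m).const_mul c
  unfold act
  split_ifs
  all_goals exact (((h _ _).add (h _ _)).add (h _ _)).add (h _ _)

theorem act_mul_right (α : ℤ → 𝔻) (φ : ℤ → ℂ) (c : ℂ) (n : ℤ) :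
    act α φ n * c = act α (fun m => φ m * c) n := by
  unfold act
  split_ifs <;> ring

theorem memLp_circle_mul {f : Circle → ℂ} (hf : MemLp f 2 μ) :
    MemLp (fun z : Circle => (z : ℂ) * f z) 2 μ :=
  hf.of_le ((by fun_prop : Continuous fun z : Circle => (z : ℂ)).aestronglyMeasurable.mul hf.1)
    (Filter.Eventually.of_forall fun z => by rw [norm_mul, Circle.norm_coe, one_mul])

/-- The densities of `⟨δ_n, g(ℰ) ψ⟩`, as a sequence in `n`, solve the eigenvalue equation. -/
theorem ae_act_density_eq [IsFiniteMeasure μ] (α : ℤ → 𝔻) (ψ : EllTwo) {f : ℤ → Circle → ℂ}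
    (hf : ∀ n, MemLp (f n) 2 μ)
    (h : ∀ n (g : C(Circle, ℂ)),
      ∫ z, f n z * g z ∂μ = ⟪delta n, circleCalculus (extendedCMV α) g ψ⟫_ℂ) :
    ∀ᵐ z : Circle ∂μ, act α (fun n => f n z) = (z : ℂ) • fun n => f n z := by
  have key : ∀ n, ∀ᵐ z : Circle ∂μ, act α (fun m => f m z) n - (z : ℂ) * f n z = 0 := by
    intro n
    refine ae_eq_zero_of_integral_mul_continuous_eq_zero
      ((memLp_act α hf n).sub (memLp_circle_mul (hf n))) fun g => ?_
    have h1 : ∫ z, act α (fun m => f m z) n * g z ∂μ =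
        op α (circleCalculus (extendedCMV α) g ψ) n := by
      simp only [act_mul_right]
      rw [integral_act α (fun m => integrable_mul_continuous (hf m) g) n, op_apply]
      simp only [h, inner_delta_left]
    have h2 : ∫ z : Circle, (z : ℂ) * f n z * g z ∂μ =
        op α (circleCalculus (extendedCMV α) g ψ) n := by
      -- Multiplying the test function by `z` corresponds to applying `ℰ` to `g(ℰ) ψ`.
      have h3 := h n (circleVal * g)
      rw [map_mul, circleCalculus_circleVal, inner_delta_left] at h3
      refine Eq.trans (integral_congr_ae (Filter.Eventually.of_forall fun z => ?_)) h3
      change (z : ℂ) * f n z * g z = f n z * ((z : ℂ) * g z)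
      ring
    simp only [sub_mul]
    rw [integral_sub (integrable_mul_continuous (memLp_act α hf n) g)
      (integrable_mul_continuous (memLp_circle_mul (hf n)) g), h1, h2, sub_self]
  -- There are countably many rows, so one null set serves all `n`.
  filter_upwards [ae_all_iff.mpr key] with z hz
  ext n
  exact sub_eq_zero.mp (hz n)

/-- With the summable weights `w n = (1 + |n|)⁻²`, the function `∑ w n |f n|²` has finite integral,
so it is finite almost everywhere; each of its terms is then at most the sum `T`, which gives `|f n
z| ≤ √T (1 + |n|)`. -/
theorem ae_exists_norm_le {f : ℤ → Circle → ℂ} (hf : ∀ n, MemLp (f n) 2 μ)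
    (h : ∀ n, eLpNorm (f n) 2 μ ≤ 1) :
    ∀ᵐ z : Circle ∂μ, ∃ R : ℝ, 0 < R ∧ ∀ n : ℤ, ‖f n z‖ ≤ R * (1 + |(n : ℝ)|) := by
  let w : ℤ → ℝ := fun n => ((1 + |(n : ℝ)|) ^ 2)⁻¹
  have hw : Summable w := by
    have hN : Summable fun n : ℕ => ((1 + (n : ℝ)) ^ 2)⁻¹ := by
      have := (summable_nat_add_iff (f := fun n : ℕ => ((n : ℝ) ^ 2)⁻¹) 1).mpr
        (Real.summable_nat_pow_inv.mpr one_lt_two)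
      refine this.congr fun n => ?_
      push_cast
      rw [add_comm]
    apply Summable.of_nat_of_neg <;> simpa [w] using hN
  have hint : ∀ n, ∫⁻ z, ‖f n z‖ₑ ^ 2 ∂μ ≤ 1 := by
    intro n
    have e := eLpNorm_nnreal_pow_eq_lintegral (f := f n) (μ := μ) (p := 2) two_ne_zero
    simp only [NNReal.coe_ofNat, ENNReal.rpow_ofNat, ENNReal.coe_ofNat] at e
    rw [← e]
    exact pow_le_one₀ zero_le (h n)
  have hmeas : ∀ n, AEMeasurable (fun z => ENNReal.ofReal (w n) * ‖f n z‖ₑ ^ 2) μ :=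
    fun n => ((hf n).1.enorm.pow_const 2).const_mul _
  have hfin : ∫⁻ z, ∑' n, ENNReal.ofReal (w n) * ‖f n z‖ₑ ^ 2 ∂μ ≠ ∞ := by
    rw [lintegral_tsum hmeas]
    refine ne_top_of_le_ne_top hw.tsum_ofReal_ne_top (ENNReal.tsum_le_tsum fun n => ?_)
    rw [lintegral_const_mul' _ _ ENNReal.ofReal_ne_top]
    exact mul_le_of_le_one_right' (hint n)
  filter_upwards [ae_lt_top' (AEMeasurable.tsum hmeas) hfin] with z hz
  set T := ∑' n, ENNReal.ofReal (w n) * ‖f n z‖ₑ ^ 2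
  -- The summand 1 keeps the constant positive when `T = 0`.
  refine ⟨Real.sqrt T.toReal + 1, by positivity, fun n => ?_⟩
  have h1 : w n * ‖f n z‖ ^ 2 ≤ T.toReal := by
    have := ENNReal.toReal_mono hz.ne
      (ENNReal.le_tsum (f := fun n => ENNReal.ofReal (w n) * ‖f n z‖ₑ ^ 2) n)
    rwa [ENNReal.toReal_mul, ENNReal.toReal_ofReal (by positivity), ENNReal.toReal_pow,
      toReal_enorm] at this
  have hp : 0 < 1 + |(n : ℝ)| := by positivity
  have h2 : ‖f n z‖ ≤ Real.sqrt T.toReal * (1 + |(n : ℝ)|) := by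
    rw [← div_le_iff₀ hp]
    apply Real.le_sqrt_of_sq_le
    rw [div_pow, div_eq_inv_mul]
    exact h1
  nlinarith

theorem exists_density_delta [IsFiniteMeasure μ] (α : ℤ → 𝔻) (k : ℤ)
    (hμ : spectralMeasure (extendedCMV α) (delta k) ≤ μ) :
    ∃ f : ℤ → Circle → ℂ, (∀ n, MemLp (f n) 2 μ) ∧
      (∀ n (g : C(Circle, ℂ)),
        ∫ z, f n z * g z ∂μ = ⟪delta n, circleCalculus (extendedCMV α) g (delta k)⟫_ℂ) ∧
      ∀ᵐ z : Circle ∂μ, (fun n => f n z) ≠ 0 →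
        IsGeneralizedEigenvector α z (fun n => f n z) := by
  choose f hf hn h using fun n : ℤ => exists_density (extendedCMV α) (delta k) (delta n) hμ
  have hd : ∀ n, ‖delta n‖ = 1 := fun n => by
    rw [delta, lp.norm_single (by norm_num), norm_one]
  refine ⟨f, hf, h, ?_⟩
  filter_upwards [ae_act_density_eq α (delta k) hf h,
    ae_exists_norm_le hf fun n => by simpa [hd] using hn n] with z h1 ⟨R, hR, h2⟩ h0
  exact ⟨h0, h1, R, 1, hR, one_pos, fun n => by simpa using h2 n⟩

end AlmostEvery

instance (α : ℤ → 𝔻) : IsFiniteMeasure (canonicalSpectralMeasure α) := by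
  unfold canonicalSpectralMeasure
  infer_instance

theorem ae_mem_generalizedEigenvalues (α : ℤ → 𝔻) :
    ∀ᵐ z : Circle ∂(canonicalSpectralMeasure α), (z : ℂ) ∈ generalizedEigenvalues α := by
  set μ := canonicalSpectralMeasure α with hμ
  obtain ⟨f, hf, hfi, hfe⟩ := exists_density_delta (μ := μ) α 0 (Measure.le_add_right le_rfl)
  obtain ⟨f', hf', hfi', hfe'⟩ := exists_density_delta (μ := μ) α 1 (Measure.le_add_left le_rfl)
  have hone : MemLp (fun _ : Circle => (1 : ℂ)) 2 μ := memLp_const 1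
  -- `f 0` and `f' 1` are the densities of `μ_{δ_0}` and `μ_{δ_1}` with respect to their sum `μ`, so
  -- they add up to 1; hence the two solutions cannot both vanish identically.
  have hsum : ∀ᵐ z : Circle ∂μ, f 0 z + f' 1 z - 1 = 0 := by
    refine ae_eq_zero_of_integral_mul_continuous_eq_zero (((hf 0).add (hf' 1)).sub hone)
      fun g => ?_
    have hg := integrable_mul_continuous hone g
    have i1 := integrable_mul_continuous (hf 0) g
    have i2 := integrable_mul_continuous (hf' 1) g
    have hgi : ∀ k, Integrable g (spectralMeasure (extendedCMV α) (delta k)) := fun k =>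
      g.continuous.integrable_of_hasCompactSupport (HasCompactSupport.of_compactSpace g)
    simp only [sub_mul, add_mul]
    rw [integral_sub (i1.fun_add i2) hg, integral_add i1 i2, hfi, hfi']
    simp only [one_mul]
    rw [hμ, canonicalSpectralMeasure, integral_add_measure (hgi 0) (hgi 1),
      integral_spectralMeasure, integral_spectralMeasure, sub_self]
  filter_upwards [hfe, hfe', hsum] with z h1 h2 h3
  by_cases h0 : (fun n => f n z) = 0
  · by_cases h0' : (fun n => f' n z) = 0
    · have e := congrFun h0 0
      have e' := congrFun h0' 1
      simp only [Pi.zero_apply] at e e'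
      simp [e, e'] at h3
    · exact ⟨_, h2 h0'⟩
  · exact ⟨_, h1 h0⟩

/-! ### Cyclicity of `δ_0` and `δ_1` -/

theorem rho_pos (α : ℤ → 𝔻) (n : ℤ) : 0 < rho α n :=
  Real.sqrt_pos.mpr (by have := (α n).sq_norm_lt_one; linarith)

/-- Cramer's rule with vector unknowns; in `apply_delta_step` these are `T (delta (n - 1))` and `T
(delta (n + 2))`. -/
theorem eq_zero_of_det_ne_zero {V : Type*} [AddCommGroup V] [Module ℂ V] {a b c d : ℂ} {x y : V}
    (hdet : a * d - b * c ≠ 0) (h1 : a • x + b • y = 0) (h2 : c • x + d • y = 0) :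
    x = 0 ∧ y = 0 := by
  have hx : (a * d - b * c) • x = 0 := by
    have : (a * d - b * c) • x = d • (a • x + b • y) - b • (c • x + d • y) := by module
    rw [this, h1, h2]; simp
  have hy : (a * d - b * c) • y = 0 := by
    have : (a * d - b * c) • y = a • (c • x + d • y) - c • (a • x + b • y) := by module
    rw [this, h1, h2]; simp
  exact ⟨(smul_eq_zero.mp hx).resolve_left hdet, (smul_eq_zero.mp hy).resolve_left hdet⟩

theorem adjoint_delta (α : ℤ → 𝔻) (n : ℤ) :
    ContinuousLinearMap.adjoint (op α) (delta n) =
      if Even n then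
        conj (coeffB α n) • delta (n - 1) + conj (coeffA α n) • delta n
          + conj (coeffB α (n + 1)) • delta (n + 1) + conj (coeffD α (n + 1)) • delta (n + 2)
      else
        conj (coeffD α (n - 1)) • delta (n - 2) + conj (coeffC α (n - 1)) • delta (n - 1)
          + conj (coeffA α n) • delta n + conj (coeffC α n) • delta (n + 1) := by
  ext m
  have hm : m = n + 1 ∨ m = n ∨ m = n - 1 ∨ m = n - 2 ∨ m = n + 2 ∨
      (m ≠ n + 1 ∧ m ≠ n ∧ m ≠ n - 1 ∧ m ≠ n - 2 ∧ m ≠ n + 2) := by grind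
  rw [adjoint_apply]
  by_cases hn : Even n
  · rw [if_pos hn]
    simp only [lp.coeFn_add, lp.coeFn_smul, Pi.add_apply, Pi.smul_apply, smul_eq_mul, delta_apply]
    rcases hm with rfl | rfl | rfl | rfl | rfl | hm <;> grind
  · rw [if_neg hn]
    simp only [lp.coeFn_add, lp.coeFn_smul, Pi.add_apply, Pi.smul_apply, smul_eq_mul, delta_apply]
    rcases hm with rfl | rfl | rfl | rfl | rfl | hm <;> grind

section Cyclic

variable {α : ℤ → 𝔻} {T : EllTwo →L[ℂ] EllTwo}

set_option maxHeartbeats 800000 in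
/-- If `T` commutes with `ℰ` and its adjoint and annihilates two neighbouring basis vectors, then
it annihilates their outer neighbours. -/
theorem apply_delta_step (h1 : Commute T (op α))
    (h2 : Commute T (ContinuousLinearMap.adjoint (op α))) {n : ℤ}
    (h : T (delta n) = 0 ∧ T (delta (n + 1)) = 0) :
    T (delta (n - 1)) = 0 ∧ T (delta (n + 2)) = 0 := by
  obtain ⟨h0, h0'⟩ := h
  have comm : ∀ {A : EllTwo →L[ℂ] EllTwo}, Commute T A → ∀ m, T (delta m) = 0 →
      T (A (delta m)) = 0 := by
    intro A hA m hm
    have := congrArg (fun B : EllTwo →L[ℂ] EllTwo => B (delta m)) hA.eq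
    simp only [mul_apply_eq_comp] at this
    rw [this, hm, map_zero]
  have p0 : (rho α (n - 1) : ℂ) ≠ 0 := by exact_mod_cast (rho_pos α (n - 1)).ne'
  have p1 : (rho α (n + 1) : ℂ) ≠ 0 := by exact_mod_cast (rho_pos α (n + 1)).ne'
  have r := rho_sq_complex α n
  have e1 : n + 1 - 1 = n := by ring
  have e2 : n + 1 - 2 = n - 1 := by ring
  have e3 : n + 1 + 1 = n + 2 := by ring
  -- For even `n` it is `ℰ*`, for odd `n` it is `ℰ`, that maps both `δ_n` and `δ_{n+1}` into the
  -- span of `δ_{n-1}, …, δ_{n+2}`. Applying `T` leaves two equations in two unknowns, whose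
  -- determinant is `-ρ_{n-1} ρ_{n+1} (|α_n|² + ρ_n²) = -ρ_{n-1} ρ_{n+1}`, nonzero since every
  -- `|α_m| < 1`.
  by_cases hn : Even n
  · have hn' : ¬ Even (n + 1) := by grind
    have a1 := comm h2 n h0
    have a2 := comm h2 (n + 1) h0'
    rw [adjoint_delta, if_pos hn] at a1
    rw [adjoint_delta, if_neg hn'] at a2
    simp only [e1, e2, e3, map_add, map_smul, h0, h0', smul_zero, add_zero] at a1 a2
    refine eq_zero_of_det_ne_zero ?_ a1 a2
    have : conj (coeffB α n) * conj (coeffC α (n + 1)) - conj (coeffD α (n + 1)) * conj (coeffD α n)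
        = -((rho α (n - 1) : ℂ) * rho α (n + 1)) := by
      simp only [coeffB, coeffC, coeffD, map_neg, map_mul, Complex.conj_conj, Complex.conj_ofReal,
        e1]
      linear_combination (-(rho α (n - 1) : ℂ) * rho α (n + 1)) * r
    rw [this]
    exact neg_ne_zero.mpr (mul_ne_zero p0 p1)
  · have hn' : Even (n + 1) := by grind
    have a1 := comm h1 n h0
    have a2 := comm h1 (n + 1) h0'
    rw [op_delta, if_neg hn] at a1
    rw [op_delta, if_pos hn'] at a2
    rw [e1, e2, e3] at a2
    simp only [map_add, map_smul, h0, h0', smul_zero, add_zero] at a1 a2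
    rw [add_comm] at a2
    refine eq_zero_of_det_ne_zero ?_ a1 a2
    have : coeffB α n * coeffC α (n + 1) - coeffD α (n + 1) * coeffD α n
        = -((rho α (n - 1) : ℂ) * rho α (n + 1)) := by
      simp only [coeffB, coeffC, coeffD, e1]
      linear_combination (-(rho α (n - 1) : ℂ) * rho α (n + 1)) * r
    rw [this]
    exact neg_ne_zero.mpr (mul_ne_zero p0 p1)

/-- The neighbour step propagates in both directions from the pair `0, 1` to all basis vectors, and
`T` is continuous. This is cyclicity of `δ_0, δ_1` in the form needed for functions of `ℰ`. -/
theorem eq_zero_of_apply_delta_zero_one (h1 : Commute T (op α))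
    (h2 : Commute T (ContinuousLinearMap.adjoint (op α)))
    (h : T (delta 0) = 0 ∧ T (delta 1) = 0) : T = 0 := by
  have pair : ∀ n : ℤ, T (delta n) = 0 ∧ T (delta (n + 1)) = 0 := by
    intro n
    induction n using Int.induction_on with
    | zero => simpa using h
    | succ k ih => exact ⟨ih.2, by simpa [add_assoc] using (apply_delta_step h1 h2 ih).2⟩
    | pred k ih => exact ⟨(apply_delta_step h1 h2 ih).1, by simpa using ih.1⟩
  ext1 φ
  have hs := (lp.hasSum_single (p := 2) (by norm_num) φ).mapL T
  refine hs.unique ?_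
  rw [zero_apply]
  convert hasSum_zero with n
  have : lp.single 2 n (φ n) = φ n • delta n := by
    rw [delta, ← lp.single_smul, smul_eq_mul, mul_one]
  rw [this, map_smul, (pair n).1, smul_zero]

end Cyclic

/-- `g(ℰ)` kills `δ_0` and `δ_1` because `‖g(ℰ) δ_k‖² = ∫ |g|² dμ_{δ_k}`, and it commutes with `ℰ`
and `ℰ*`. -/
theorem circleCalculus_eq_zero (α : ℤ → 𝔻) {g : C(Circle, ℂ)}
    (hg : g =ᵐ[canonicalSpectralMeasure α] 0) : circleCalculus (extendedCMV α) g = 0 := by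
  have hcomm : Commute (circleCalculus (extendedCMV α) g) (op α) := by
    have h : Commute g circleVal := Commute.all _ _
    have := h.map (circleCalculus (extendedCMV α))
    rwa [circleCalculus_circleVal] at this
  have hcomm' : Commute (circleCalculus (extendedCMV α) g)
      (ContinuousLinearMap.adjoint (op α)) := by
    have h : Commute g (star circleVal) := Commute.all _ _
    have := h.map (circleCalculus (extendedCMV α))
    rwa [map_star, circleCalculus_circleVal] at this
  have hz : ∀ k, spectralMeasure (extendedCMV α) (delta k) ≤ canonicalSpectralMeasure α →
      circleCalculus (extendedCMV α) g (delta k) = 0 := by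
    intro k hk
    have h : ‖circleCalculus (extendedCMV α) g (delta k)‖ ^ 2 = 0 := by
      rw [norm_circleCalculus_sq]
      refine integral_eq_zero_of_ae ?_
      filter_upwards [ae_mono hk hg] with z hz
      simp [hz]
    simpa using h
  exact eq_zero_of_apply_delta_zero_one hcomm hcomm'
    ⟨hz 0 (Measure.le_add_right le_rfl), hz 1 (Measure.le_add_left le_rfl)⟩

theorem spectrum_subset_closure_generalizedEigenvalues (α : ℤ → 𝔻) :
    spectrum ℂ (op α) ⊆ closure (generalizedEigenvalues α) := by
  intro z hz
  by_contra hcl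
  obtain ⟨b, hbc, hbz, hb0⟩ : ∃ b : ℂ → ℂ, Continuous b ∧ b z ≠ 0 ∧
      ∀ w ∈ generalizedEigenvalues α, b w = 0 := by
    obtain ⟨b, h0, h1, -⟩ := exists_continuous_zero_one_of_isClosed
      (isClosed_closure (s := generalizedEigenvalues α)) (isClosed_singleton (x := z))
      (Set.disjoint_singleton_right.mpr hcl)
    refine ⟨fun w => (b w : ℂ), by fun_prop, ?_, fun w hw => ?_⟩
    · simp [h1 (Set.mem_singleton z)]
    · simp [h0 (subset_closure hw)]
  let g : C(Circle, ℂ) := ⟨fun w => b w, by fun_prop⟩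
  have hg : g =ᵐ[canonicalSpectralMeasure α] 0 := by
    filter_upwards [ae_mem_generalizedEigenvalues α] with w hw using hb0 _ hw
  have hzero := circleCalculus_eq_zero α hg
  -- The calculus on the circle first restricts to the spectrum, and only the second factor `cfcHom`
  -- is injective; so `g` vanishes on the spectrum, in particular at `z`.
  have hinj := (map_eq_zero_iff _ (cfcHom_injective (R := ℂ) (a := op α) (p := IsStarNormal)
    (inferInstanceAs (IsStarNormal (extendedCMV α : EllTwo →L[ℂ] EllTwo))))).mp hzero
  exact hbz (DFunLike.congr_fun hinj ⟨z, hz⟩)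

end CMV
end

theorem mainTheorem3 (α : ℤ → 𝔻) :
    CMV.generalizedEigenvalues α ⊆
        spectrum ℂ (CMV.extendedCMV α : CMV.EllTwo →L[ℂ] CMV.EllTwo) ∧
      CMV.canonicalSpectralMeasure α
        {z : Circle | (z : ℂ) ∈ spectrum ℂ (CMV.extendedCMV α : CMV.EllTwo →L[ℂ] CMV.EllTwo) \
          CMV.generalizedEigenvalues α} = 0 ∧
      closure (CMV.generalizedEigenvalues α) =
        spectrum ℂ (CMV.extendedCMV α : CMV.EllTwo →L[ℂ] CMV.EllTwo) := by
  have ha := CMV.generalizedEigenvalues_subset_spectrum α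
  refine ⟨ha, ?_, (closure_minimal ha (spectrum.isClosed _)).antisymm
    (CMV.spectrum_subset_closure_generalizedEigenvalues α)⟩
  -- The whole complement of `𝒢` in the circle is already null.
  exact MeasureTheory.measure_mono_null (fun z hz => hz.2) (CMV.ae_mem_generalizedEigenvalues α)
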